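/- Let $m,n\ge 1$, let $1\le p\le\infty$, and let $q$ be the exponent conjugate to $p$, so $1/p+1/q=1$ with $1/\infty=0$. For a real $m\times n$ matrix $M$ let $$\|M\|_{\infty\to p}=\max_{u\in\mathbb R^n,\ u\ne 0}\frac{\|Mu\|_p}{\|u\|_\infty}.$$ Let $A$ be a fixed real $m\times n$ matrix, let $D>0$, and let $X$ be a random real $m\times n$ matrix whose entries $X_{jk}$ are independent, with $\mathbb E X_{jk}=A_{jk}$ and $|X_{jk}|\le D/2$ almost surely for all $j,k$. Then $\|A-X\|_{\infty\to p}$ is integrable and, for all $t>0$, $$\mathbb P\left(\|A-X\|_{\infty\to p}>\mathbb E\|A-X\|_{\infty\to p}+t\right)\le \exp\left(-\frac{t^2}{4D^2\,n\,m^{s}}\right),\qquad s=\max\{0,\,1-2/q\}.$$ -/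

import Mathlib

open MeasureTheory ProbabilityTheory
open scoped ENNReal

/-- The `∞ → p` norm of a real `m × n` matrix `M`, for `1 ≤ p ≤ ∞`: the operator norm of `u ↦ M u`,
regarded as an operator from `ℓ_∞^n` to `ℓ_p^m`, i.e. the maximum of `‖M u‖_p / ‖u‖_∞`
over `u ≠ 0` (and `0` when `n = 0`). -/
noncomputable def inftyToPNorm {m n : ℕ} (p : ℝ≥0∞) [Fact (1 ≤ p)]
    (M : Matrix (Fin m) (Fin n) ℝ) : ℝ :=
  ‖LinearMap.toContinuousLinearMap (Matrix.toLpLin ∞ p M)‖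

/-!
The proof is Maurey's transfer argument for convex functions. A probability measure `ν` with a cost
`c` has the convex property `(τ)` if `(∫ exp g) (∫ exp (-f)) ≤ 1` for all convex `f` and all `g`
below the inf-convolution of `f` and `c`, that is, `g x ≤ f y + c (x - y)` for all `x`, `y`.

* On the line, a measure carried by an interval of length at most `D` has the property for the cost
  `z ^ 2 / (4 * D ^ 2)` (`convexPropertyTau_of_ae_mem_Icc`): if `f` is minimal at `y`, moving from
  `x` towards `y` by a well-chosen fraction gives `exp (g x) ≤ 2 - exp (-f x)` when `f y = 0`, and
  `(2 - u) * u ≤ 1`.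
* The property tensorizes, with costs adding up (`ConvexPropertyTau.prod`, `ConvexPropertyTau.pi`):
  with `Q x y` the inf-convolution of `f (x, ·)` in the second variable, `log ∫ exp (Q x y) dν' y`
  is again convex in `x`, and the property of the first factor applies to it.
* If `(f x - f y) ^ 2 ≤ 4 * V * c (x - y)`, then `l * f - l ^ 2 * V` lies below the
  inf-convolution of `l * f` and `c`, so that Jensen's inequality gives
  `∫ exp (l * (f - ∫ f)) ≤ exp (l ^ 2 * V)`, and Chernoff's bound with `l = t / (2 * V)` gives
  the tail `exp (-t ^ 2 / (4 * V))` (`ConvexPropertyTau.measureReal_lt_le`).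

The function `M ↦ ‖A - M‖_{∞→p}` is convex, and comparing the `p`-norm with the Euclidean norm shows
that the square of its Lipschitz constant for the Frobenius norm is at most `n * m ^ s`
(`inftyToPNorm_sq_le`), which gives `V = D ^ 2 * n * m ^ s`.
-/

open scoped NNReal

/-! ### The convex property `(τ)` and measures on an interval -/

/-- Maurey's convex property `(τ)` of a measure `ν` with respect to a cost `c`. Instead of the
inf-convolution of `f` and `c` itself, the inequality is stated for every Lipschitz function `g`
below it. The cost is required to be convex and to grow faster than any multiple of the norm, so
that inf-convolutions with Lipschitz functions are finite; compactness of the support makes every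
continuous function integrable. -/
structure ConvexPropertyTau {E : Type*} [NormedAddCommGroup E] [NormedSpace ℝ E]
    [MeasurableSpace E] (ν : Measure E) (c : E → ℝ) : Prop where
  convexOn_cost : ConvexOn ℝ Set.univ c
  bddBelow_cost : ∀ K : ℝ≥0, BddBelow (Set.range fun z => c z - K * ‖z‖)
  exists_isCompact : ∃ S : Set E, IsCompact S ∧ ∀ᵐ x ∂ν, x ∈ S
  integral_mul_integral_le_one : ∀ (K K' : ℝ≥0) (f g : E → ℝ), ConvexOn ℝ Set.univ f →
    LipschitzWith K f → LipschitzWith K' g → (∀ x y, g x ≤ f y + c (x - y)) →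
      (∫ x, Real.exp (g x) ∂ν) * ∫ x, Real.exp (-f x) ∂ν ≤ 1

theorem Continuous.integrable_of_ae_mem_isCompact {E : Type*} [TopologicalSpace E] [T2Space E]
    [MeasurableSpace E] [BorelSpace E] {ν : Measure E} [IsFiniteMeasure ν] {f : E → ℝ}
    (hf : Continuous f) {S : Set E} (hS : IsCompact S) (h : ∀ᵐ x ∂ν, x ∈ S) :
    Integrable f ν := by
  have := hf.continuousOn.integrableOn_compact (μ := ν) hS
  rwa [IntegrableOn, Measure.restrict_eq_self_of_ae_mem h] at this

/-- The scalar inequality behind the one-dimensional case; `a` is the excess of a convex function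
over its minimum, and `θ` the fraction of the way moved towards the minimizer. -/
theorem exists_exp_interpolation_le {a : ℝ} (ha : 0 ≤ a) :
    ∃ θ : ℝ, 0 ≤ θ ∧ θ ≤ 1 ∧ Real.exp ((1 - θ) * a + θ ^ 2 / 4) ≤ 2 - Real.exp (-a) := by
  -- The minimizing fraction is `min (2 * a) 1`; for `a = b ≤ 1 / 2` the claim amounts to
  -- `exp (-b ^ 2 / 2) * cosh (b - b ^ 2 / 2) ≤ 1`.
  have key : ∀ b : ℝ, 0 ≤ b → b ≤ 1 / 2 → Real.exp (b - b ^ 2) ≤ 2 - Real.exp (-b) := by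
    intro b hb0 hb1
    have h1 : Real.exp (b - b ^ 2) + Real.exp (-b) =
        2 * Real.exp (-(b ^ 2 / 2)) * Real.cosh (b - b ^ 2 / 2) := by
      rw [Real.cosh_eq]
      have e1 : Real.exp (b - b ^ 2) = Real.exp (-(b ^ 2 / 2)) * Real.exp (b - b ^ 2 / 2) := by
        rw [← Real.exp_add]; ring_nf
      have e2 : Real.exp (-b) = Real.exp (-(b ^ 2 / 2)) * Real.exp (-(b - b ^ 2 / 2)) := by
        rw [← Real.exp_add]; ring_nf
      rw [e1, e2]; ring
    have h2 : Real.cosh (b - b ^ 2 / 2) ≤ Real.exp (b ^ 2 / 2) := by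
      refine (Real.cosh_le_exp_half_sq _).trans (Real.exp_le_exp.2 ?_)
      have : (b - b ^ 2 / 2) ^ 2 ≤ b ^ 2 := by
        apply pow_le_pow_left₀ <;> nlinarith
      linarith
    have h3 : Real.exp (-(b ^ 2 / 2)) * Real.exp (b ^ 2 / 2) = 1 := by
      rw [← Real.exp_add]; simp
    have := mul_le_mul_of_nonneg_left h2 (Real.exp_pos (-(b ^ 2 / 2))).le
    linarith
  rcases le_total a (1 / 2) with h | h
  · refine ⟨2 * a, by linarith, by linarith, ?_⟩
    convert key a ha h using 2
    ring
  · refine ⟨1, zero_le_one, le_rfl, ?_⟩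
    have h1 := key (1 / 2) (by norm_num) le_rfl
    have h2 : Real.exp (-a) ≤ Real.exp (-(1 / 2)) := Real.exp_le_exp.2 (by linarith)
    have h3 : (1 - 1) * a + (1 : ℝ) ^ 2 / 4 = 1 / 2 - (1 / 2) ^ 2 := by ring
    rw [h3]; linarith

theorem convexPropertyTau_of_ae_mem_Icc {ν : Measure ℝ} [IsProbabilityMeasure ν] {a b D : ℝ}
    (hD : 0 < D) (hab : b - a ≤ D) (hν : ∀ᵐ x ∂ν, x ∈ Set.Icc a b) :
    ConvexPropertyTau ν fun z => z ^ 2 / (4 * D ^ 2) where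
  convexOn_cost := by
    have h := (even_two.convexOn_pow (𝕜 := ℝ)).smul (c := (4 * D ^ 2)⁻¹) (by positivity)
    convert! h using 1
    ext z; simp [div_eq_inv_mul]
  bddBelow_cost K := by
    refine ⟨-(K ^ 2 * D ^ 2), ?_⟩
    rintro _ ⟨z, rfl⟩
    have h : z ^ 2 / (4 * D ^ 2) - K * ‖z‖ + K ^ 2 * D ^ 2 = (|z| / (2 * D) - K * D) ^ 2 := by
      rw [← sq_abs z, Real.norm_eq_abs]; field_simp; ring
    have := sq_nonneg (|z| / (2 * D) - K * D)
    dsimp only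
    linarith
  exists_isCompact := ⟨Set.Icc a b, isCompact_Icc, hν⟩
  integral_mul_integral_le_one := by
    intro K K' f g hf hfK hgK hfg
    have hne : (Set.Icc a b).Nonempty := hν.exists
    obtain ⟨y, hy, hmin⟩ := isCompact_Icc.exists_isMinOn hne hfK.continuous.continuousOn
    have hig : Integrable (fun x => Real.exp (g x)) ν :=
      (Real.continuous_exp.comp hgK.continuous).integrable_of_ae_mem_isCompact isCompact_Icc hν
    have hif : Integrable (fun x => Real.exp (-f x)) ν :=
      (Real.continuous_exp.comp hfK.continuous.neg).integrable_of_ae_mem_isCompact isCompact_Icc hν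
    have hpt : ∀ x ∈ Set.Icc a b,
        Real.exp (g x) ≤ 2 * Real.exp (f y) - Real.exp (f y) ^ 2 * Real.exp (-f x) := by
      intro x hx
      obtain ⟨θ, h0, h1, hθ⟩ := exists_exp_interpolation_le (sub_nonneg.2 (hmin hx))
      have hc := hf.2 (Set.mem_univ x) (Set.mem_univ y) (sub_nonneg.2 h1) h0 (by ring)
      have hg := hfg x ((1 - θ) • x + θ • y)
      have hsq : (x - y) ^ 2 ≤ D ^ 2 := by
        apply sq_le_sq'
        · linarith [hx.1, hy.2]
        · linarith [hx.2, hy.1]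
      have hcost : (x - ((1 - θ) • x + θ • y)) ^ 2 / (4 * D ^ 2) ≤ θ ^ 2 / 4 := by
        rw [div_le_div_iff₀ (by positivity) (by norm_num)]
        simp only [smul_eq_mul]
        nlinarith [mul_le_mul_of_nonneg_left hsq (sq_nonneg θ)]
      simp only [smul_eq_mul] at hc hg hcost
      have hle : g x ≤ f y + ((1 - θ) * (f x - f y) + θ ^ 2 / 4) := by linarith
      calc Real.exp (g x) ≤ Real.exp (f y) * Real.exp ((1 - θ) * (f x - f y) + θ ^ 2 / 4) := by
            rw [← Real.exp_add]; exact Real.exp_le_exp.2 hle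
        _ ≤ Real.exp (f y) * (2 - Real.exp (-(f x - f y))) := by gcongr
        _ = _ := by
            rw [neg_sub, sub_eq_add_neg (f y) (f x), Real.exp_add]; ring
    have hint : ∫ x, Real.exp (g x) ∂ν ≤
        2 * Real.exp (f y) - Real.exp (f y) ^ 2 * ∫ x, Real.exp (-f x) ∂ν := by
      calc _ ≤ ∫ x, (2 * Real.exp (f y) - Real.exp (f y) ^ 2 * Real.exp (-f x)) ∂ν :=
            integral_mono_ae hig ((integrable_const _).sub (hif.const_mul _))
              (hν.mono fun x hx => hpt x hx)
        _ = _ := by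
            rw [integral_sub (integrable_const _) (hif.const_mul _),
              integral_const_mul (Real.exp (f y) ^ 2)]
            simp
    have hI : 0 ≤ ∫ x, Real.exp (-f x) ∂ν := integral_nonneg fun x => (Real.exp_pos _).le
    nlinarith [mul_le_mul_of_nonneg_right hint hI,
      sq_nonneg (Real.exp (f y) * (∫ x, Real.exp (-f x) ∂ν) - 1)]

/-- The log-integral-exp of a family of convex functions is convex. Hölder's inequality is replaced
by convexity of `exp` after normalizing both integrals to `1`. -/
theorem convexOn_log_integral_exp {E F : Type*} [AddCommGroup E] [Module ℝ E] [MeasurableSpace F]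
    {ν : Measure F} [NeZero ν] {h : E → F → ℝ} (hconv : ∀ y, ConvexOn ℝ Set.univ fun x => h x y)
    (hint : ∀ x, Integrable (fun y => Real.exp (h x y)) ν) :
    ConvexOn ℝ Set.univ fun x => Real.log (∫ y, Real.exp (h x y) ∂ν) := by
  refine ⟨convex_univ, fun u _ v _ a b ha hb hab => ?_⟩
  have hpos : ∀ x, 0 < ∫ y, Real.exp (h x y) ∂ν := fun x => integral_exp_pos (hint x)
  set A := Real.log (∫ y, Real.exp (h u y) ∂ν) with hA
  set B := Real.log (∫ y, Real.exp (h v y) ∂ν) with hB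
  have hnorm : ∀ x, ∫ y, Real.exp (h x y - Real.log (∫ y, Real.exp (h x y) ∂ν)) ∂ν = 1 := by
    intro x
    simp_rw [Real.exp_sub, Real.exp_log (hpos x)]
    rw [integral_div, div_self (hpos x).ne']
  have hint' : ∀ x (r : ℝ), Integrable (fun y => Real.exp (h x y - r)) ν := by
    intro x r
    simp_rw [Real.exp_sub]
    exact (hint x).div_const _
  rw [Real.log_le_iff_le_exp (hpos _)]
  have hpt : ∀ y, Real.exp (h (a • u + b • v) y - (a • A + b • B)) ≤
      a * Real.exp (h u y - A) + b * Real.exp (h v y - B) := by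
    intro y
    have h1 := (hconv y).2 (Set.mem_univ u) (Set.mem_univ v) ha hb hab
    have h2 := convexOn_exp.2 (Set.mem_univ (h u y - A)) (Set.mem_univ (h v y - B)) ha hb hab
    refine le_trans (Real.exp_le_exp.2 ?_) h2
    simp only [smul_eq_mul] at h1 ⊢
    linarith
  have hle : ∫ y, Real.exp (h (a • u + b • v) y - (a • A + b • B)) ∂ν ≤ 1 := by
    calc _ ≤ ∫ y, (a * Real.exp (h u y - A) + b * Real.exp (h v y - B)) ∂ν :=
          integral_mono (hint' _ _) (((hint' _ _).const_mul _).add ((hint' _ _).const_mul _)) hpt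
      _ = 1 := by
          rw [integral_add ((hint' _ _).const_mul _) ((hint' _ _).const_mul _),
            integral_const_mul, integral_const_mul, hnorm u, hnorm v]
          linarith
  simp_rw [Real.exp_sub] at hle
  rwa [integral_div, div_le_one (Real.exp_pos _)] at hle

theorem lipschitzWith_log_integral_exp {E F : Type*} [PseudoMetricSpace E] [MeasurableSpace F]
    {ν : Measure F} [NeZero ν] {h : E → F → ℝ} {K : ℝ≥0}
    (hlip : ∀ y, LipschitzWith K fun x => h x y)
    (hint : ∀ x, Integrable (fun y => Real.exp (h x y)) ν) :
    LipschitzWith K fun x => Real.log (∫ y, Real.exp (h x y) ∂ν) := by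
  refine LipschitzWith.of_le_add_mul K fun u v => ?_
  have hpos : ∀ x, 0 < ∫ y, Real.exp (h x y) ∂ν := fun x => integral_exp_pos (hint x)
  rw [Real.log_le_iff_le_exp (hpos u), Real.exp_add, Real.exp_log (hpos v), ← integral_mul_const]
  refine integral_mono (hint u) ((hint v).mul_const _) fun y => ?_
  dsimp only
  rw [← Real.exp_add]
  exact Real.exp_le_exp.2 ((hlip y).le_add_mul u v)

/-! ### Inf-convolution in one of two variables -/

section InfConv

variable {E F : Type*} [NormedAddCommGroup E] [NormedAddCommGroup F]

/-- The inf-convolution of `f` and the cost `c` in the second variable, the first one being a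
parameter; the infimum runs over the displacement `z`. It is meaningful when the infimum is over a
set bounded below, as it is for Lipschitz `f` and superlinear `c`. -/
noncomputable def partialInfConv (c : F → ℝ) (f : E × F → ℝ) (x : E × F) : ℝ :=
  ⨅ z, f (x.1, x.2 - z) + c z

variable {c : F → ℝ} {f : E × F → ℝ} {K : ℝ≥0}

theorem bddBelow_range_partialInfConv (hc : ∀ K : ℝ≥0, BddBelow (Set.range fun z => c z - K * ‖z‖))
    (hf : LipschitzWith K f) (x : E × F) :
    BddBelow (Set.range fun z => f (x.1, x.2 - z) + c z) := by
  obtain ⟨B, hB⟩ := hc K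
  refine ⟨f x + B, ?_⟩
  rintro _ ⟨z, rfl⟩
  have h1 : B ≤ c z - K * ‖z‖ := hB ⟨z, rfl⟩
  have h2 := hf.le_add_mul x (x.1, x.2 - z)
  have h3 : dist x (x.1, x.2 - z) = ‖z‖ := by
    rw [dist_eq_norm, Prod.norm_def]; simp
  rw [h3] at h2
  dsimp only
  linarith

theorem partialInfConv_le (hc : ∀ K : ℝ≥0, BddBelow (Set.range fun z => c z - K * ‖z‖))
    (hf : LipschitzWith K f) (x : E) (y y' : F) :
    partialInfConv c f (x, y) ≤ f (x, y') + c (y - y') := by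
  have := ciInf_le (bddBelow_range_partialInfConv hc hf (x, y)) (y - y')
  simpa [partialInfConv] using this

theorem lipschitzWith_partialInfConv
    (hc : ∀ K : ℝ≥0, BddBelow (Set.range fun z => c z - K * ‖z‖))
    (hf : LipschitzWith K f) : LipschitzWith K (partialInfConv c f) := by
  refine LipschitzWith.of_le_add_mul K fun u v => ?_
  rw [← sub_le_iff_le_add]
  refine le_ciInf fun z => ?_
  have h1 := ciInf_le (bddBelow_range_partialInfConv hc hf u) z
  have h2 := hf.le_add_mul (u.1, u.2 - z) (v.1, v.2 - z)
  have h3 : dist (u.1, u.2 - z) (v.1, v.2 - z) = dist u v := by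
    simp [Prod.dist_eq]
  rw [h3] at h2
  change partialInfConv c f u ≤ _ at h1
  linarith

/-- The partial inf-convolution is jointly convex, being a partial infimum of a jointly convex
function. -/
theorem convexOn_partialInfConv [NormedSpace ℝ E] [NormedSpace ℝ F]
    (hc : ∀ K : ℝ≥0, BddBelow (Set.range fun z => c z - K * ‖z‖))
    (hcc : ConvexOn ℝ Set.univ c) (hf : LipschitzWith K f) (hfc : ConvexOn ℝ Set.univ f) :
    ConvexOn ℝ Set.univ (partialInfConv c f) := by
  refine ⟨convex_univ, fun u _ v _ a b ha hb hab => ?_⟩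
  simp only [partialInfConv, smul_eq_mul]
  rw [Real.mul_iInf_of_nonneg ha, Real.mul_iInf_of_nonneg hb]
  refine le_ciInf_add_ciInf fun z w => ?_
  refine (ciInf_le (bddBelow_range_partialInfConv hc hf _) (a • z + b • w)).trans ?_
  have h1 := hfc.2 (Set.mem_univ (u.1, u.2 - z)) (Set.mem_univ (v.1, v.2 - w)) ha hb hab
  have h2 := hcc.2 (Set.mem_univ z) (Set.mem_univ w) ha hb hab
  have h3 : a • (u.1, u.2 - z) + b • (v.1, v.2 - w) =
      ((a • u + b • v).1, (a • u + b • v).2 - (a • z + b • w)) := by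
    ext
    · simp
    · simp only [Prod.snd_add, Prod.smul_snd, smul_sub]; abel
  rw [h3] at h1
  simp only [smul_eq_mul] at h1 h2
  linarith

end InfConv

/-! ### Tensorization -/

namespace ConvexPropertyTau

variable {E F : Type*} [NormedAddCommGroup E] [NormedSpace ℝ E] [MeasurableSpace E] [BorelSpace E]
  [NormedAddCommGroup F] [NormedSpace ℝ F] [MeasurableSpace F] [BorelSpace F]

omit [BorelSpace E] in
theorem of_subsingleton [Subsingleton E] (ν : Measure E) [IsProbabilityMeasure ν] :
    ConvexPropertyTau ν fun _ => 0 where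
  convexOn_cost := convexOn_const 0 convex_univ
  bddBelow_cost K := (Set.finite_range _).bddBelow
  exists_isCompact := ⟨Set.univ, Set.subsingleton_univ.isCompact, by simp⟩
  integral_mul_integral_le_one := by
    intro K K' f g _ _ _ hfg
    have hg : (fun x => Real.exp (g x)) = fun _ => Real.exp (g 0) := by
      ext x; rw [Subsingleton.elim x 0]
    have hf : (fun x => Real.exp (-f x)) = fun _ => Real.exp (-f 0) := by
      ext x; rw [Subsingleton.elim x 0]
    rw [hg, hf]
    simp only [integral_const, probReal_univ, one_smul]
    rw [← Real.exp_add, Real.exp_le_one_iff]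
    linarith [hfg 0 0]

theorem integrable {ν : Measure E} [IsFiniteMeasure ν] {c : E → ℝ} (h : ConvexPropertyTau ν c)
    {f : E → ℝ} (hf : Continuous f) : Integrable f ν :=
  let ⟨_, hS, hν⟩ := h.exists_isCompact
  hf.integrable_of_ae_mem_isCompact hS hν

theorem map {ν : Measure E} {c : E → ℝ} (h : ConvexPropertyTau ν c) (e : E ≃L[ℝ] F) :
    ConvexPropertyTau (ν.map e) (c ∘ e.symm) where
  convexOn_cost := by
    simpa using! h.convexOn_cost.comp_linearMap (e.symm : F →ₗ[ℝ] E)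
  bddBelow_cost K := by
    obtain ⟨B, hB⟩ := h.bddBelow_cost (K * ‖(e : E →L[ℝ] F)‖₊)
    refine ⟨B, ?_⟩
    rintro _ ⟨w, rfl⟩
    have h1 : B ≤ c (e.symm w) - ↑(K * ‖(e : E →L[ℝ] F)‖₊) * ‖e.symm w‖ := hB ⟨e.symm w, rfl⟩
    have h2 := (e : E →L[ℝ] F).le_opNorm (e.symm w)
    simp only [ContinuousLinearEquiv.coe_coe, ContinuousLinearEquiv.apply_symm_apply] at h2
    have h3 := mul_le_mul_of_nonneg_left h2 K.2
    simp only [NNReal.coe_mul, coe_nnnorm, Function.comp_apply, NNReal.val_eq_coe] at h1 h3 ⊢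
    linarith
  exists_isCompact := by
    obtain ⟨S, hS, hν⟩ := h.exists_isCompact
    refine ⟨e '' S, hS.image e.continuous, ?_⟩
    refine (ae_map_iff e.continuous.measurable.aemeasurable
      (hS.image e.continuous).isClosed.measurableSet).2 ?_
    exact hν.mono fun x hx => Set.mem_image_of_mem _ hx
  integral_mul_integral_le_one := by
    intro K K' f g hf hfK hgK hfg
    have hemb := e.toHomeomorph.measurableEmbedding
    have h1 := hemb.integral_map (μ := ν) fun x => Real.exp (g x)
    have h2 := hemb.integral_map (μ := ν) fun x => Real.exp (-f x)
    simp only [ContinuousLinearEquiv.coe_toHomeomorph] at h1 h2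
    rw [h1, h2]
    refine h.integral_mul_integral_le_one _ _ (f ∘ e) (g ∘ e) ?_
      (hfK.comp (e : E →L[ℝ] F).lipschitz) (hgK.comp (e : E →L[ℝ] F).lipschitz) fun x y => ?_
    · simpa using! hf.comp_linearMap (e : E →ₗ[ℝ] F)
    · simpa using! hfg (e x) (e y)

omit [NormedSpace ℝ E] [BorelSpace E] [NormedSpace ℝ F] [BorelSpace F] in
theorem exists_isCompact_ae_mem_prod {ν : Measure E} {ν' : Measure F} [SFinite ν] [SFinite ν']
    (h : ∃ S : Set E, IsCompact S ∧ ∀ᵐ x ∂ν, x ∈ S)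
    (h' : ∃ S : Set F, IsCompact S ∧ ∀ᵐ x ∂ν', x ∈ S) :
    ∃ S : Set (E × F), IsCompact S ∧ ∀ᵐ z ∂ν.prod ν', z ∈ S := by
  obtain ⟨S, hS, hν⟩ := h
  obtain ⟨S', hS', hν'⟩ := h'
  refine ⟨S ×ˢ S', hS.prod hS', ?_⟩
  filter_upwards [Measure.quasiMeasurePreserving_fst.ae hν,
    Measure.quasiMeasurePreserving_snd.ae hν'] with z h1 h2 using ⟨h1, h2⟩

/-- The convex property `(τ)` passes to products, the cost being the sum of the costs. -/
theorem prod [SecondCountableTopology E] [SecondCountableTopology F]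
    {ν : Measure E} {ν' : Measure F} [IsProbabilityMeasure ν] [IsProbabilityMeasure ν']
    {c : E → ℝ} {c' : F → ℝ} (h : ConvexPropertyTau ν c) (h' : ConvexPropertyTau ν' c') :
    ConvexPropertyTau (ν.prod ν') fun z => c z.1 + c' z.2 where
  convexOn_cost := by
    have h1 := h.convexOn_cost.comp_linearMap (LinearMap.fst ℝ E F)
    have h2 := h'.convexOn_cost.comp_linearMap (LinearMap.snd ℝ E F)
    exact h1.add h2
  bddBelow_cost K := by
    obtain ⟨B, hB⟩ := h.bddBelow_cost K
    obtain ⟨B', hB'⟩ := h'.bddBelow_cost K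
    refine ⟨B + B', ?_⟩
    rintro _ ⟨z, rfl⟩
    have h1 : B ≤ c z.1 - K * ‖z.1‖ := hB ⟨z.1, rfl⟩
    have h2 : B' ≤ c' z.2 - K * ‖z.2‖ := hB' ⟨z.2, rfl⟩
    have h3 : K * ‖z‖ ≤ K * (‖z.1‖ + ‖z.2‖) := by
      refine mul_le_mul_of_nonneg_left ?_ K.2
      rw [Prod.norm_def]
      exact max_le (by linarith [norm_nonneg z.2]) (by linarith [norm_nonneg z.1])
    dsimp only
    linarith
  exists_isCompact := exists_isCompact_ae_mem_prod h.exists_isCompact h'.exists_isCompact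
  integral_mul_integral_le_one := by
    intro K K' f g hf hfK hgK hfg
    obtain ⟨S, hS, hν⟩ := exists_isCompact_ae_mem_prod h.exists_isCompact h'.exists_isCompact
    have hint : ∀ {u : E × F → ℝ}, Continuous u → Integrable u (ν.prod ν') :=
      fun hu => hu.integrable_of_ae_mem_isCompact hS hν
    have hmk : ∀ y : F, LipschitzWith 1 fun x : E => (x, y) := LipschitzWith.prodMk_right
    have hmk' : ∀ x : E, LipschitzWith 1 fun y : F => (x, y) := LipschitzWith.prodMk_left
    have hQ := lipschitzWith_partialInfConv h'.bddBelow_cost hfK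
    have hQc := convexOn_partialInfConv h'.bddBelow_cost h'.convexOn_cost hfK hf
    set Q := partialInfConv c' f
    have hQint : ∀ x, Integrable (fun y => Real.exp (Q (x, y))) ν' := fun x =>
      h'.integrable (by have := hQ.continuous; fun_prop)
    have hgint : ∀ x, Integrable (fun y => Real.exp (g (x, y))) ν' := fun x =>
      h'.integrable (by have := hgK.continuous; fun_prop)
    have hQpos : ∀ x, 0 < ∫ y, Real.exp (Q (x, y)) ∂ν' := fun x => integral_exp_pos (hQint x)
    have hgpos : ∀ x, 0 < ∫ y, Real.exp (g (x, y)) ∂ν' := fun x => integral_exp_pos (hgint x)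
    have hφc : ConvexOn ℝ Set.univ fun x => Real.log (∫ y, Real.exp (Q (x, y)) ∂ν') := by
      refine convexOn_log_integral_exp (h := fun x y => Q (x, y)) (fun y => ?_) hQint
      refine ⟨convex_univ, fun u _ v _ a b ha hb hab => ?_⟩
      have := hQc.2 (Set.mem_univ (u, y)) (Set.mem_univ (v, y)) ha hb hab
      rwa [Prod.smul_mk, Prod.smul_mk, Prod.mk_add_mk, ← add_smul, hab, one_smul] at this
    have hφL : LipschitzWith K fun x => Real.log (∫ y, Real.exp (Q (x, y)) ∂ν') :=
      lipschitzWith_log_integral_exp (h := fun x y => Q (x, y))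
        (fun y => by simpa using! hQ.comp (hmk y)) hQint
    have hγL : LipschitzWith K' fun x => Real.log (∫ y, Real.exp (g (x, y)) ∂ν') :=
      lipschitzWith_log_integral_exp (h := fun x y => g (x, y))
        (fun y => by simpa using! hgK.comp (hmk y)) hgint
    -- `log ∫ exp g` lies below the inf-convolution of `log ∫ exp Q` and `c`.
    have hle := h.integral_mul_integral_le_one K K' _ _ hφc hφL hγL fun x x' => by
      rw [Real.log_le_iff_le_exp (hgpos x), Real.exp_add, Real.exp_log (hQpos x'),
        ← integral_mul_const]
      refine integral_mono (hgint x) ((hQint x').mul_const _) fun y => ?_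
      dsimp only
      rw [← Real.exp_add, Real.exp_le_exp, ← sub_le_iff_le_add]
      refine le_ciInf fun z => ?_
      have := hfg (x, y) (x', y - z)
      simp only [Prod.mk_sub_mk, sub_sub_cancel] at this ⊢
      linarith
    have hg2 : ∫ z, Real.exp (g z) ∂ν.prod ν' =
        ∫ x, Real.exp (Real.log (∫ y, Real.exp (g (x, y)) ∂ν')) ∂ν := by
      have hgi : Integrable (fun z => Real.exp (g z)) (ν.prod ν') :=
        hint (Real.continuous_exp.comp hgK.continuous)
      rw [integral_prod _ hgi]
      simp_rw [Real.exp_log (hgpos _)]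
    have hf2 : ∫ z, Real.exp (-f z) ∂ν.prod ν' ≤
        ∫ x, Real.exp (-Real.log (∫ y, Real.exp (Q (x, y)) ∂ν')) ∂ν := by
      have hfi : Integrable (fun z => Real.exp (-f z)) (ν.prod ν') :=
        hint (Real.continuous_exp.comp hfK.continuous.neg)
      rw [integral_prod _ hfi]
      refine integral_mono hfi.integral_prod_left
        (h.integrable (Real.continuous_exp.comp hφL.continuous.neg)) fun x => ?_
      dsimp only
      rw [Real.exp_neg, Real.exp_log (hQpos x), ← one_div, le_div_iff₀ (hQpos x), mul_comm]
      refine h'.integral_mul_integral_le_one K K (fun y => f (x, y)) (fun y => Q (x, y)) ?_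
        (by simpa using! hfK.comp (hmk' x)) (by simpa using! hQ.comp (hmk' x))
        fun y y' => partialInfConv_le h'.bddBelow_cost hfK x y y'
      refine ⟨convex_univ, fun u _ v _ a b ha hb hab => ?_⟩
      have := hf.2 (Set.mem_univ (x, u)) (Set.mem_univ (x, v)) ha hb hab
      rwa [Prod.smul_mk, Prod.smul_mk, Prod.mk_add_mk, ← add_smul, hab, one_smul] at this
    rw [hg2]
    exact (mul_le_mul_of_nonneg_left hf2
      (integral_nonneg fun x => (Real.exp_pos _).le)).trans hle

/-- A product of measures on the line with the property for the same cost `c` has it for the cost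
`∑ i, c (z i)`. -/
theorem pi {N : ℕ} {ν : Fin N → Measure ℝ} [∀ i, IsProbabilityMeasure (ν i)] {c : ℝ → ℝ}
    (h : ∀ i, ConvexPropertyTau (ν i) c) :
    ConvexPropertyTau (Measure.pi ν) fun z => ∑ i, c (z i) := by
  induction N with
  | zero => simpa using! of_subsingleton (Measure.pi ν)
  | succ N ih =>
    have h1 := ((h 0).prod (ih fun i => h i.succ)).map (Fin.consEquivL ℝ fun _ : Fin (N + 1) => ℝ)
    have h2 := (measurePreserving_piFinSuccAbove ν 0).symm.map_eq
    convert! h1 using 1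
    · simpa using! h2.symm
    · ext z
      rw [Fin.sum_univ_succ]
      rfl

/-- Concentration above the mean for a convex function whose increments are controlled by the
cost. -/
theorem measureReal_lt_le {ν : Measure E} [IsProbabilityMeasure ν] {c : E → ℝ}
    (h : ConvexPropertyTau ν c) {f : E → ℝ} {K : ℝ≥0} {V : ℝ} (hV : 0 < V)
    (hf : ConvexOn ℝ Set.univ f) (hfK : LipschitzWith K f)
    (hfc : ∀ x y, (f x - f y) ^ 2 ≤ 4 * V * c (x - y)) {t : ℝ} (ht : 0 < t) :
    ν.real {x | (∫ y, f y ∂ν) + t < f x} ≤ Real.exp (-t ^ 2 / (4 * V)) := by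
  -- The minimizer of `l ^ 2 * V - l * t`.
  set l : ℝ := t / (2 * V) with hl
  have hl0 : 0 < l := by positivity
  have hfi : Integrable f ν := h.integrable hfK.continuous
  have hlK : LipschitzWith (l.toNNReal * K) fun x => l * f x := by
    refine LipschitzWith.of_le_add_mul _ fun x y => ?_
    have := mul_le_mul_of_nonneg_left (hfK.le_add_mul x y) hl0.le
    rw [NNReal.coe_mul, Real.coe_toNNReal _ hl0.le]
    linarith
  have hexp : Integrable (fun x => Real.exp (l * f x)) ν :=
    h.integrable (Real.continuous_exp.comp hlK.continuous)
  have htau := h.integral_mul_integral_le_one (l.toNNReal * K) (l.toNNReal * K)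
    (fun x => l * f x) (fun x => l * f x + -(l ^ 2 * V)) (hf.smul hl0.le) hlK
    (by simpa using! hlK.add (LipschitzWith.const (-(l ^ 2 * V)))) fun x y => by
      have h1 := hfc x y
      have h2 : 4 * V * (l * (f x - f y)) ≤ 4 * V * (l ^ 2 * V + c (x - y)) := by
        nlinarith [sq_nonneg (2 * V * l - (f x - f y))]
      have h3 := le_of_mul_le_mul_left h2 (by positivity)
      linarith
  have hjensen : Real.exp (-(l * ∫ x, f x ∂ν)) ≤ ∫ x, Real.exp (-(l * f x)) ∂ν := by
    have h1 := convexOn_exp.map_integral_le (μ := ν) (f := fun x => -(l * f x))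
      Real.continuous_exp.continuousOn isClosed_univ (by simp) (hfi.const_mul l).neg
      (h.integrable (Real.continuous_exp.comp hlK.continuous.neg))
    rwa [integral_neg, integral_const_mul] at h1
  have hlaplace : ∫ x, Real.exp (l * f x) ∂ν ≤ Real.exp (l * (∫ x, f x ∂ν) + l ^ 2 * V) := by
    simp_rw [Real.exp_add] at htau
    rw [integral_mul_const] at htau
    have h1 : 0 ≤ (∫ x, Real.exp (l * f x) ∂ν) * Real.exp (-(l ^ 2 * V)) :=
      mul_nonneg (integral_nonneg fun x => (Real.exp_pos _).le) (Real.exp_pos _).le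
    have h2 := (mul_le_mul_of_nonneg_left hjensen h1).trans htau
    rw [mul_assoc, ← Real.exp_add, ← le_div_iff₀ (Real.exp_pos _), one_div, ← Real.exp_neg] at h2
    refine h2.trans_eq ?_
    congr 1; ring
  have hch := measure_ge_le_exp_mul_mgf (μ := ν) (X := f) ((∫ y, f y ∂ν) + t) hl0.le hexp
  calc ν.real {x | (∫ y, f y ∂ν) + t < f x}
      ≤ ν.real {x | (∫ y, f y ∂ν) + t ≤ f x} :=
        measureReal_mono (Set.ofPred_subset_ofPred.2 fun x hx => hx.le)
    _ ≤ Real.exp (-l * ((∫ y, f y ∂ν) + t)) * ∫ x, Real.exp (l * f x) ∂ν := hch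
    _ ≤ Real.exp (-l * ((∫ y, f y ∂ν) + t)) * Real.exp (l * (∫ x, f x ∂ν) + l ^ 2 * V) := by
        gcongr
    _ = Real.exp (-t ^ 2 / (4 * V)) := by
        rw [← Real.exp_add]
        congr 1
        rw [hl]; field_simp; ring

end ConvexPropertyTau

/-! ### The `∞ → p` norm and the Frobenius norm -/

/-- Comparison of the `p`-norm with the Euclidean norm: for `p ≤ 2` by the power mean inequality,
with the factor `card ι ^ (2 / p - 1)` for the squares, and for `p ≥ 2` without a factor. -/
theorem PiLp.norm_sq_le_card_rpow_mul_sum_sq {ι : Type*} [Fintype ι] (p : ℝ≥0∞) [Fact (1 ≤ p)]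
    (y : PiLp p fun _ : ι => ℝ) :
    ‖y‖ ^ 2 ≤ (Fintype.card ι : ℝ) ^ (max 0 (2 * (p⁻¹).toReal - 1)) * ∑ j, y j ^ 2 := by
  have hp1 : 1 ≤ p := Fact.out
  have hS : 0 ≤ ∑ j, y j ^ 2 := Finset.sum_nonneg fun j _ => sq_nonneg _
  have hle : ∀ j, |y j| ≤ √(∑ j, y j ^ 2) := fun j => Real.abs_le_sqrt
    (Finset.single_le_sum (f := fun j => y j ^ 2) (fun j _ => sq_nonneg _) (Finset.mem_univ j))
  rcases eq_or_ne p ∞ with rfl | hp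
  · have h1 : ‖y‖ ≤ √(∑ j, y j ^ 2) := by
      rw [PiLp.norm_eq_ciSup]
      exact Real.iSup_le hle (Real.sqrt_nonneg _)
    have h2 := pow_le_pow_left₀ (norm_nonneg y) h1 2
    rw [Real.sq_sqrt hS] at h2
    simpa using h2
  have hr1 : 1 ≤ p.toReal := by
    simpa using ENNReal.toReal_mono hp hp1
  have hr0 : 0 < p.toReal := by linarith
  rw [ENNReal.toReal_inv, PiLp.norm_eq_sum hr0]
  have hT : 0 ≤ ∑ j, ‖y j‖ ^ p.toReal := Finset.sum_nonneg fun j _ => by positivity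
  have hsq : ((∑ j, ‖y j‖ ^ p.toReal) ^ (1 / p.toReal)) ^ 2 =
      (∑ j, ‖y j‖ ^ p.toReal) ^ (2 / p.toReal) := by
    rw [← Real.rpow_natCast, ← Real.rpow_mul hT]
    congr 1
    push_cast; ring
  rw [hsq]
  rcases le_total p.toReal 2 with h2 | h2
  · have hq : 1 ≤ 2 / p.toReal := by rwa [le_div_iff₀ hr0, one_mul]
    have h3 := Real.rpow_sum_le_const_mul_sum_rpow Finset.univ (fun j => ‖y j‖ ^ p.toReal) hq
    have h4 : ∀ j, |‖y j‖ ^ p.toReal| ^ (2 / p.toReal) = y j ^ 2 := by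
      intro j
      rw [abs_of_nonneg (by positivity), ← Real.rpow_mul (norm_nonneg _),
        mul_div_cancel₀ _ hr0.ne', Real.rpow_two, Real.norm_eq_abs, sq_abs]
    have h5 : ∀ j, |‖y j‖ ^ p.toReal| = ‖y j‖ ^ p.toReal := fun j =>
      abs_of_nonneg (by positivity)
    simp_rw [h4, h5] at h3
    rwa [max_eq_right (by rw [← div_eq_mul_inv]; linarith), ← div_eq_mul_inv]
  · have hmax : 2 * (p.toReal)⁻¹ - 1 ≤ 0 := by
      rw [← div_eq_mul_inv, sub_nonpos, div_le_one hr0]; exact h2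
    rw [max_eq_left hmax, Real.rpow_zero, one_mul]
    -- With `S = ∑ yⱼ²` one has `|yⱼ| ≤ √S`, hence `|yⱼ| ^ r ≤ √S ^ (r - 2) * yⱼ²` for `r ≥ 2`.
    have h3 : ∑ j, ‖y j‖ ^ p.toReal ≤ (∑ j, y j ^ 2) ^ (p.toReal / 2) := by
      calc ∑ j, ‖y j‖ ^ p.toReal
          ≤ ∑ j, √(∑ j, y j ^ 2) ^ (p.toReal - 2) * y j ^ 2 := by
            refine Finset.sum_le_sum fun j _ => ?_
            rcases eq_or_ne (y j) 0 with h0 | h0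
            · simp [h0, Real.zero_rpow hr0.ne']
            have hpos : 0 < ‖y j‖ := norm_pos_iff.2 h0
            rw [← sq_abs (y j), ← Real.norm_eq_abs, ← Real.rpow_two (‖y j‖)]
            calc ‖y j‖ ^ p.toReal = ‖y j‖ ^ (p.toReal - 2) * ‖y j‖ ^ (2 : ℝ) := by
                  rw [← Real.rpow_add hpos]; ring_nf
              _ ≤ _ := by
                  gcongr ?_ * _
                  exact Real.rpow_le_rpow hpos.le (hle j) (by linarith)
        _ = √(∑ j, y j ^ 2) ^ (p.toReal - 2) * ∑ j, y j ^ 2 := by rw [Finset.mul_sum]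
        _ = (∑ j, y j ^ 2) ^ (p.toReal / 2) := by
            rw [Real.sqrt_eq_rpow, ← Real.rpow_mul hS]
            rcases hS.eq_or_lt with h0 | h0
            · rw [← h0, mul_zero, Real.zero_rpow (by positivity)]
            · nth_rewrite 2 [← Real.rpow_one (∑ j, y j ^ 2)]
              rw [← Real.rpow_add h0]; ring_nf
    calc _ ≤ ((∑ j, y j ^ 2) ^ (p.toReal / 2)) ^ (2 / p.toReal) := by gcongr
      _ = _ := by
          rw [← Real.rpow_mul hS, div_mul_div_comm, mul_comm, div_self (by positivity),
            Real.rpow_one]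

theorem inftyToPNorm_sq_le {m n : ℕ} (p : ℝ≥0∞) [Fact (1 ≤ p)] (M : Matrix (Fin m) (Fin n) ℝ) :
    inftyToPNorm p M ^ 2 ≤
      n * (m : ℝ) ^ (max 0 (2 * (p⁻¹).toReal - 1)) * ∑ j, ∑ k, M j k ^ 2 := by
  set s := max 0 (2 * (p⁻¹).toReal - 1)
  have hF : 0 ≤ ∑ j, ∑ k, M j k ^ 2 :=
    Finset.sum_nonneg fun j _ => Finset.sum_nonneg fun k _ => sq_nonneg _
  have hB : 0 ≤ n * (m : ℝ) ^ s * ∑ j, ∑ k, M j k ^ 2 := by positivity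
  refine (Real.le_sqrt (norm_nonneg _) hB).1 ?_
  refine ContinuousLinearMap.opNorm_le_bound _ (Real.sqrt_nonneg _) fun u => ?_
  rw [← Real.sqrt_sq (norm_nonneg u), ← Real.sqrt_mul hB]
  refine Real.le_sqrt_of_sq_le ?_
  have h1 := PiLp.norm_sq_le_card_rpow_mul_sum_sq p (Matrix.toLpLin ∞ p M u)
  rw [Fintype.card_fin] at h1
  refine h1.trans ?_
  have hu : ∑ k, u k ^ 2 ≤ n * ‖u‖ ^ 2 := by
    calc ∑ k, u k ^ 2 ≤ ∑ _k : Fin n, ‖u‖ ^ 2 := by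
          refine Finset.sum_le_sum fun k _ => ?_
          rw [← sq_abs, ← Real.norm_eq_abs]
          exact pow_le_pow_left₀ (norm_nonneg _) (PiLp.norm_apply_le u k) 2
      _ = _ := by simp
  have h2 : ∀ j, Matrix.toLpLin ∞ p M u j ^ 2 ≤ (∑ k, M j k ^ 2) * (n * ‖u‖ ^ 2) := by
    intro j
    have h3 : Matrix.toLpLin ∞ p M u j = ∑ k, M j k * u k := rfl
    rw [h3]
    exact (Finset.sum_mul_sq_le_sq_mul_sq _ _ _).trans (by gcongr)
  calc _ ≤ (m : ℝ) ^ s * ∑ j, (∑ k, M j k ^ 2) * (n * ‖u‖ ^ 2) := by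
        gcongr with j; exact h2 j
    _ = _ := by rw [← Finset.sum_mul]; ring

theorem max_zero_one_sub_two_div_toReal {p q : ℝ≥0∞} (hpq : p.HolderConjugate q) :
    max 0 (1 - (2 / q).toReal) = max 0 (2 * (p⁻¹).toReal - 1) := by
  have h1 : p⁻¹ + q⁻¹ = 1 := hpq.inv_add_inv_eq_one
  have hp' : p⁻¹ ≠ ∞ := ne_top_of_le_ne_top ENNReal.one_ne_top (h1 ▸ le_self_add)
  have hq' : q⁻¹ ≠ ∞ := ne_top_of_le_ne_top ENNReal.one_ne_top (h1 ▸ le_add_self)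
  have h2 := congrArg ENNReal.toReal h1
  rw [ENNReal.toReal_add hp' hq', ENNReal.toReal_one] at h2
  rw [div_eq_mul_inv, ENNReal.toReal_mul, ENNReal.toReal_ofNat]
  congr 1
  linarith

theorem abs_inftyToPNorm_sub_le {m n : ℕ} (p : ℝ≥0∞) [Fact (1 ≤ p)]
    (M N : Matrix (Fin m) (Fin n) ℝ) :
    |inftyToPNorm p M - inftyToPNorm p N| ≤ inftyToPNorm p (M - N) := by
  simp only [inftyToPNorm, map_sub]
  exact abs_norm_sub_norm_le _ _

theorem convexOn_inftyToPNorm {m n : ℕ} (p : ℝ≥0∞) [Fact (1 ≤ p)] :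
    ConvexOn ℝ Set.univ (inftyToPNorm p : Matrix (Fin m) (Fin n) ℝ → ℝ) := by
  refine ⟨convex_univ, fun M _ N _ a b ha hb _ => ?_⟩
  simp only [inftyToPNorm, map_add, map_smul]
  refine (norm_add_le _ _).trans_eq ?_
  rw [norm_smul, norm_smul, Real.norm_of_nonneg ha, Real.norm_of_nonneg hb]
  rfl

/-! ### Concentration for independent bounded variables -/

/-- Convex concentration for independent variables in an interval of length `D`: `√L` is a
Lipschitz constant of `f` for the Euclidean norm, in terms of squares. -/
theorem integrable_and_measureReal_lt_le_of_iIndepFun {Ω ι : Type*} [Fintype ι] [MeasurableSpace Ω]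
    {μ : Measure Ω} [IsProbabilityMeasure μ] {Y : ι → Ω → ℝ} {D L : ℝ} (hD : 0 < D) (hL : 0 < L)
    (hmeas : ∀ i, Measurable (Y i)) (hindep : iIndepFun Y μ)
    (hbound : ∀ i, ∀ᵐ ω ∂μ, |Y i ω| ≤ D / 2) {f : (ι → ℝ) → ℝ} (hf : ConvexOn ℝ Set.univ f)
    (hfL : ∀ x y, (f x - f y) ^ 2 ≤ L * ∑ i, (x i - y i) ^ 2) :
    Integrable (fun ω => f fun i => Y i ω) μ ∧ ∀ t, 0 < t →
      μ.real {ω | (∫ ω', f (fun i => Y i ω') ∂μ) + t < f fun i => Y i ω} ≤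
        Real.exp (-t ^ 2 / (4 * D ^ 2 * L)) := by
  set e := (Fintype.equivFin ι).symm
  set N := Fintype.card ι
  set Z : Ω → Fin N → ℝ := fun ω i => Y (e i) ω with hZ
  have hZm : Measurable Z := measurable_pi_lambda _ fun i => hmeas (e i)
  set F : (Fin N → ℝ) → ℝ := fun x => f fun i => x (e.symm i) with hF
  have hFZ : ∀ ω, F (Z ω) = f fun i => Y i ω := fun ω => by simp [hF, hZ]
  have hlaw : μ.map Z = Measure.pi fun i => μ.map (Y (e i)) :=
    (iIndepFun_iff_map_fun_eq_pi_map fun i => (hmeas (e i)).aemeasurable).1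
      (hindep.precomp e.injective)
  have hprob : ∀ i, IsProbabilityMeasure (μ.map (Y (e i))) := fun i =>
    Measure.isProbabilityMeasure_map (hmeas _).aemeasurable
  have hprobZ : IsProbabilityMeasure (μ.map Z) := Measure.isProbabilityMeasure_map hZm.aemeasurable
  have htau : ConvexPropertyTau (μ.map Z) fun z => ∑ i, z i ^ 2 / (4 * D ^ 2) := by
    rw [hlaw]
    refine ConvexPropertyTau.pi fun i =>
      convexPropertyTau_of_ae_mem_Icc hD (a := -(D / 2)) (b := D / 2) (by linarith) ?_
    refine (ae_map_iff (hmeas _).aemeasurable measurableSet_Icc).2 ?_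
    exact (hbound (e i)).mono fun ω hω => abs_le.1 hω
  have hFc : ConvexOn ℝ Set.univ F := by
    simpa using! hf.comp_linearMap (LinearMap.funLeft ℝ ℝ e.symm)
  have hFL : ∀ x y, (F x - F y) ^ 2 ≤ L * ∑ i, (x i - y i) ^ 2 := by
    intro x y
    have := hfL (fun i => x (e.symm i)) (fun i => y (e.symm i))
    rwa [Equiv.sum_comp e.symm fun i => (x i - y i) ^ 2] at this
  have hFlip : LipschitzWith (Real.toNNReal √(L * N)) F := by
    refine LipschitzWith.of_le_add_mul _ fun x y => ?_
    rw [Real.coe_toNNReal _ (Real.sqrt_nonneg _), ← sub_le_iff_le_add']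
    refine (le_abs_self _).trans (abs_le_of_sq_le_sq ?_ (by positivity))
    rw [mul_pow, Real.sq_sqrt (by positivity), mul_assoc]
    refine (hFL x y).trans (mul_le_mul_of_nonneg_left ?_ hL.le)
    calc ∑ i, (x i - y i) ^ 2 ≤ ∑ _i : Fin N, dist x y ^ 2 := by
          refine Finset.sum_le_sum fun i _ => ?_
          rw [← sq_abs, ← Real.dist_eq]
          exact pow_le_pow_left₀ dist_nonneg (dist_le_pi_dist x y i) 2
      _ = N * dist x y ^ 2 := by simp
  have hlt := fun t (ht : 0 < t) => htau.measureReal_lt_le (V := D ^ 2 * L) (by positivity) hFc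
    hFlip (fun x y => by
      refine (hFL x y).trans_eq ?_
      rw [← Finset.sum_div]
      simp only [Pi.sub_apply]
      field_simp) ht
  have hint := htau.integrable hFlip.continuous
  refine ⟨?_, fun t ht => ?_⟩
  · simpa only [Function.comp_def, hFZ] using hint.comp_measurable hZm
  · have h1 := hlt t ht
    rw [integral_map hZm.aemeasurable hFlip.continuous.aestronglyMeasurable,
      map_measureReal_apply hZm
        (measurableSet_lt measurable_const hFlip.continuous.measurable)] at h1
    simp only [hFZ, Set.preimage_ofPred_eq] at h1
    rwa [mul_assoc]

theorem theorem4p5 {Ω : Type*} [MeasurableSpace Ω] (μ : Measure Ω) [IsProbabilityMeasure μ]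
    {m n : ℕ} (p q : ℝ≥0∞) [Fact (1 ≤ p)] (hpq : p.HolderConjugate q)
    (A : Matrix (Fin m) (Fin n) ℝ) (X : Ω → Matrix (Fin m) (Fin n) ℝ) (D : ℝ)
    (hmeas : ∀ j k, Measurable fun ω => X ω j k)
    (hindep : iIndepFun (fun (jk : Fin m × Fin n) (ω : Ω) => X ω jk.1 jk.2) μ)
    (hmean : ∀ j k, ∫ ω, X ω j k ∂μ = A j k)
    (hbound : ∀ j k, ∀ᵐ ω ∂μ, |X ω j k| ≤ D / 2) :
    Integrable (fun ω => inftyToPNorm p (A - X ω)) μ ∧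
      ∀ t : ℝ, 0 < t →
        μ.real {ω | (∫ ω', inftyToPNorm p (A - X ω') ∂μ) + t < inftyToPNorm p (A - X ω)} ≤
          Real.exp (-t ^ 2 / (4 * D ^ 2 * n * (m : ℝ) ^ (max 0 (1 - (2 / q).toReal)))) := by
  set L : ℝ := n * (m : ℝ) ^ (max 0 (1 - (2 / q).toReal)) with hL
  have hL0 : 0 ≤ L := by positivity
  set f : (Fin m × Fin n → ℝ) → ℝ :=
    fun x => inftyToPNorm p (A - Matrix.of fun j k => x (j, k)) with hf
  have hconv : ConvexOn ℝ Set.univ f := by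
    refine ⟨convex_univ, fun x _ y _ a b ha hb hab => ?_⟩
    have hcomb : A - Matrix.of (fun j k => (a • x + b • y) (j, k)) =
        a • (A - Matrix.of fun j k => x (j, k)) + b • (A - Matrix.of fun j k => y (j, k)) := by
      ext j k
      simp only [Matrix.sub_apply, Matrix.of_apply, Matrix.add_apply, Matrix.smul_apply,
        Pi.add_apply, Pi.smul_apply, smul_eq_mul]
      linear_combination (-A j k) * hab
    rw [hf]
    dsimp only
    rw [hcomb]
    exact (convexOn_inftyToPNorm p).2 (Set.mem_univ _) (Set.mem_univ _) ha hb hab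
  have hlip : ∀ x y, (f x - f y) ^ 2 ≤ L * ∑ i, (x i - y i) ^ 2 := by
    intro x y
    have h1 := abs_inftyToPNorm_sub_le p (A - Matrix.of fun j k => x (j, k))
      (A - Matrix.of fun j k => y (j, k))
    rw [← sq_abs]
    refine (pow_le_pow_left₀ (abs_nonneg _) h1 2).trans ?_
    refine (inftyToPNorm_sq_le p _).trans_eq ?_
    rw [← max_zero_one_sub_two_div_toReal hpq, ← hL, Fintype.sum_prod_type]
    congr 1
    refine Finset.sum_congr rfl fun j _ => Finset.sum_congr rfl fun k _ => ?_
    simp only [Matrix.sub_apply, Matrix.of_apply]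
    ring
  have hmeas' : ∀ i : Fin m × Fin n, Measurable fun ω => X ω i.1 i.2 := fun i => hmeas i.1 i.2
  have hbound' : ∀ E : ℝ, D ≤ E → ∀ i : Fin m × Fin n, ∀ᵐ ω ∂μ, |X ω i.1 i.2| ≤ E / 2 :=
    fun E hE i => (hbound i.1 i.2).mono fun ω hω => hω.trans (by linarith)
  refine ⟨?_, fun t ht => ?_⟩
  · -- Enlarging `D` and `L` makes them positive, which is harmless for integrability.
    exact (integrable_and_measureReal_lt_le_of_iIndepFun (D := |D| + 1) (L := L + 1) (by positivity)
      (by positivity) hmeas' hindep (hbound' _ (by linarith [le_abs_self D])) hconv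
      fun x y => (hlip x y).trans (by gcongr; linarith)).1
  · rw [mul_assoc (4 * D ^ 2), ← hL]
    rcases hL0.eq_or_lt with h0 | h0
    · -- Division by zero makes the right-hand side `exp 0 = 1`; likewise for `D = 0`.
      rw [← h0]
      simp
    rcases eq_or_ne D 0 with hD | hD
    · rw [hD]
      simp
    rw [← sq_abs D]
    exact (integrable_and_measureReal_lt_le_of_iIndepFun (abs_pos.2 hD) h0 hmeas' hindep
      (hbound' _ (le_abs_self D)) hconv hlip).2 t ht
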